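/- Let $K$ be a field that is complete with respect to a nontrivial non-Archimedean absolute value $|\cdot|$, and let $\widehat K$ be the completion of an algebraic closure of $K$, with the extended absolute value. Write $D_r(0)$, $\overline D_r(0)$, $S_r(0)$ for the open disc, the closed disc and the sphere of radius $r>0$ about $0$. Let $f(x)=\lambda x+\sum_{i\ge 2}a_ix^i\in K[[x]]$ with $|\lambda|=1$ and $a=\sup_{i\ge2}|a_i|^{1/(i-1)}<\infty$. Suppose that $f$ is linearizable with conjugacy function $g$, i.e. $g=\sum_{k\ge1} b_kx^k\in K[[x]]$ has positive radius of convergence, $g(0)=0$, $g'(0)=1$ and $g\circ f=\lambda g$. For a nonzero power series $h=\sum_k c_kx^k$ over $\widehat K$ converging on a rational closed disc $\overline D_R(0)$ (that is, $R\in|\widehat K^*|$), and for $0<r\le R$, let $\deg(h,\overline D_r(0))$ and $\deg(h,D_r(0))$ (the Weierstrass degrees) be respectively the largest and the smallest index $k\ge0$ at which $|c_k|r^k$ attains its maximum over all indices. Let $0<\tau<1/a$ (with $1/a=\infty$ if $a=0$), and suppose that $g$ converges on a rational closed disc of $\widehat K$ containing $\overline D_\tau(0)$, and that in $\widehat K$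 $$\deg(g,D_\tau(0))=1,\qquad \deg(g,\overline D_\tau(0))=d>1 .$$ Then $f$ has an indifferent periodic point in $\widehat K$ on the sphere $S_\tau(0)$ of period $\kappa\le d$: there are $\hat x\in\widehat K$ with $|\hat x|=\tau$ and $1\le\kappa\le d$ such that the forward orbit of $\hat x$ under $f$ stays where $f$ converges, $\kappa$ is the least period of $\hat x$, and $|(f^{\circ\kappa})'(\hat x)|=1$. Moreover, $D_\tau(0)$ is the linearization disc of $f$ about the fixed point $0$ (both in $\widehat K$ and in $K$), i.e. the largest open or closed disc $U$ of positive radius about $0$ such that the full conjugacy $g\circ f\circ g^{-1}(x)=\lambda x$ holds for all $x\in U$. Here $g^{-1}$ is the power series inverse to $g$ under composition, and the full conjugacy holding at $x$ includes that the series converge where they are evaluated and that $g(g^{-1}(x))=x$. -/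

import Mathlib

open scoped PowerSeries

noncomputable section

namespace NonArch

section Khat

variable (K : Type*) [NontriviallyNormedField K] [IsUltrametricDist K] [CompleteSpace K]

/-- The algebraic closure of a complete non-Archimedean field, with the unique extension of the
absolute value (the spectral norm). -/
instance algClosureNormedField : NormedField (AlgebraicClosure K) :=
  spectralNorm.normedField K (AlgebraicClosure K)

instance algClosureNormedAlgebra : NormedAlgebra K (AlgebraicClosure K) :=
  spectralNorm.normedAlgebra K (AlgebraicClosure K)

/-- `Khat K` is the completion of the algebraic closure of `K`. -/
abbrev Khat : Type _ := UniformSpace.Completion (AlgebraicClosure K)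

theorem norm_algebraMap_Khat (x : K) : ‖algebraMap K (Khat K) x‖ = ‖x‖ :=
  norm_algebraMap' (Khat K) x

instance khatNontriviallyNormedField : NontriviallyNormedField (Khat K) where
  __ := (inferInstance : NormedField (Khat K))
  non_trivial := by
    obtain ⟨x, hx⟩ := NontriviallyNormedField.non_trivial (α := K)
    exact ⟨algebraMap K (Khat K) x, by rw [norm_algebraMap_Khat]; exact hx⟩

/-- A power series over `K`, regarded as a power series over `Khat K`. -/
def toKhat (h : K⟦X⟧) : (Khat K)⟦X⟧ := PowerSeries.map (algebraMap K (Khat K)) h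

end Khat

section Field

variable {L : Type*} [NontriviallyNormedField L]

/-- The power series `h` converges at the point `x`. -/
def ConvergesAt (h : L⟦X⟧) (x : L) : Prop :=
  Summable fun k : ℕ => PowerSeries.coeff k h * x ^ k

/-- The value of the power series `h` at `x` (meaningful where `h` converges). -/
def value (h : L⟦X⟧) (x : L) : L := ∑' k : ℕ, PowerSeries.coeff k h * x ^ k

/-- `g` is a conjugacy function of `f(x) = λ x + ⋯`: a convergent power series with `g(0) = 0`,
`g'(0) = 1`, satisfying the Schröder functional equation `g ∘ f = λ g` as formal power series. -/
structure IsConjugacy (f g : L⟦X⟧) : Prop where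
  coeff_zero : PowerSeries.coeff 0 g = 0
  coeff_one : PowerSeries.coeff 1 g = 1
  schroeder : PowerSeries.subst f g = PowerSeries.C (PowerSeries.coeff 1 f) * g
  convergent : ∃ r : ℝ, 0 < r ∧ ∀ x : L, ‖x‖ < r → ConvergesAt g x

/-- The indices `k` at which `|c_k| r ^ k` attains its maximum, where `h = ∑ c_k x ^ k`. -/
def dominantIndices (h : L⟦X⟧) (r : ℝ) : Set ℕ :=
  {k | ∀ j : ℕ, ‖PowerSeries.coeff j h‖ * r ^ j ≤ ‖PowerSeries.coeff k h‖ * r ^ k}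

/-- `h` is nonzero, `r > 0`, and `h` converges on some rational closed disc about `0` (one whose
radius is the absolute value of a nonzero element) that contains the closed disc of radius `r`.
This is what the Weierstrass degree on discs of radius `r` about `0` presupposes. -/
def DegreeDefined (h : L⟦X⟧) (r : ℝ) : Prop :=
  h ≠ 0 ∧ 0 < r ∧ ∃ c : L, c ≠ 0 ∧ r ≤ ‖c‖ ∧ ∀ x : L, ‖x‖ ≤ ‖c‖ → ConvergesAt h x

/-- The Weierstrass degree of `h` on the closed disc of radius `r` about `0` is `d`. -/
def HasDegreeOnClosedDisc (h : L⟦X⟧) (r : ℝ) (d : ℕ) : Prop :=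
  DegreeDefined h r ∧ IsGreatest (dominantIndices h r) d

/-- The Weierstrass degree of `h` on the open disc of radius `r` about `0` is `d`. -/
def HasDegreeOnOpenDisc (h : L⟦X⟧) (r : ℝ) (d : ℕ) : Prop :=
  DegreeDefined h r ∧ IsLeast (dominantIndices h r) d

/-- `x` is an indifferent periodic point of `f` of (least) period `κ`: the whole forward orbit of
`x` lies where `f` converges, and the multiplier `(f^κ)'(x)` has absolute value one. -/
structure IsIndifferentPeriodicPt (f : L⟦X⟧) (x : L) (κ : ℕ) : Prop where
  orbit : ∀ n : ℕ, ConvergesAt f ((value f)^[n] x)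
  pos : 0 < κ
  period : Function.minimalPeriod (value f) x = κ
  indifferent : ∃ μ : L, HasDerivAt ((value f)^[κ]) μ x ∧ ‖μ‖ = 1

/-- The open and closed discs of positive radius about `0`. -/
def IsDiscAboutZero (U : Set L) : Prop :=
  ∃ r : ℝ, 0 < r ∧ (U = Metric.ball 0 r ∨ U = Metric.closedBall 0 r)

/-- The full conjugacy `g ∘ f ∘ g⁻¹ (x) = λ x`, `λ = f'(0)`, holds for all `x ∈ U`. Here `g⁻¹` is
the power series inverse to `g` under composition; all the series have to converge where they are
evaluated, and `g⁻¹` has to be a genuine inverse of `g` there. -/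
def FullConjugacyOn (f g : L⟦X⟧) (U : Set L) : Prop :=
  ∃ h : L⟦X⟧, PowerSeries.coeff 0 h = 0 ∧ PowerSeries.subst h g = PowerSeries.X ∧
    ∀ x ∈ U, ConvergesAt h x ∧ ConvergesAt g (value h x) ∧ value g (value h x) = x ∧
      ConvergesAt f (value h x) ∧ ConvergesAt g (value f (value h x)) ∧
      value g (value f (value h x)) = PowerSeries.coeff 1 f * x

/-- `U` is the linearization disc of `f` about the fixed point `0`, with respect to the conjugacy
`g`: the largest disc about `0` on which the full conjugacy holds. -/
def IsLinearizationDisc (f g : L⟦X⟧) (U : Set L) : Prop :=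
  IsGreatest {V : Set L | IsDiscAboutZero V ∧ FullConjugacyOn f g V} U

end Field

end NonArch

end

/-!
The proof compares power series coefficientwise, through the terms `|c_k| r ^ k`.

The hypothesis on the degree of `g` on the open disc says that `|b_k| τ ^ k ≤ τ` for all `k`. By the
recursion for its coefficients, the inverse series of `g` satisfies the same bounds
(`norm_coeff_inverse_le`), and `f`, an isometry on every disc of radius less than `1 / a`
(`IsIndifferentSeries.norm_value_sub`), does as well. A series with these bounds converges on
`D_τ(0)` and maps it into itself, so formal identities between compositions may be evaluated there
(`value_subst`), which gives the full conjugacy on `D_τ(0)` (`fullConjugacyOn_ball`).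

The degree of `g / X` on the closed disc is `d - 1 > 0`. The truncations of `g / X` have coefficients
in `K`, hence split in `Khat K`, and multiplicativity of the Gauss norm (`exists_factorization`) shows
that each long truncation has exactly `d - 1` roots in the closed disc, counted with multiplicity.
Following these roots gives a zero of `g / X` there (`exists_value_eq_zero`) and bounds the number of
such zeros by `d - 1` (`card_le_of_value_eq_zero`). They have absolute value exactly `τ`, because `g`
is injective on the open disc. By `g ∘ f = λ g` the isometry `f` permutes them, so each of them is
periodic of period at most `d - 1`, with a multiplier of absolute value one
(`isIndifferentPeriodicPt_of_value_eq_zero`).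

Finally, if the full conjugacy held at a point of absolute value at least `τ`, in `K` or in `Khat K`,
then the inverse series of `g` would converge on the closed disc of radius `τ` of `Khat K` and `g`
would be injective there, although it vanishes both at `0` and on the sphere (`not_tendsto_inverse`).
-/

open scoped PowerSeries

section

open PowerSeries Filter Topology

namespace NonArch

/-! ### Evaluation of power series over a complete ultrametric field -/

section Evaluation

theorem tendsto_mul_pow_of_le {c : ℕ → ℝ} (hc : ∀ k, 0 ≤ c k) {r s : ℝ} (hr : 0 ≤ r)
    (hrs : r ≤ s) (h : Tendsto (fun k => c k * s ^ k) atTop (𝓝 0)) :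
    Tendsto (fun k => c k * r ^ k) atTop (𝓝 0) :=
  squeeze_zero (fun k => mul_nonneg (hc k) (pow_nonneg hr k))
    (fun k => mul_le_mul_of_nonneg_left (pow_le_pow_left₀ hr hrs k) (hc k)) h

theorem coeff_mul_mul_pow {R : Type*} [CommRing R] (p q : R⟦X⟧) (x : R) (n : ℕ) :
    coeff n (p * q) * x ^ n = ∑ i ∈ Finset.HasAntidiagonal.antidiagonal n,
      (coeff i.1 p * x ^ i.1) * (coeff i.2 q * x ^ i.2) := by
  rw [coeff_mul, Finset.sum_mul]
  refine Finset.sum_congr rfl fun i hi => ?_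
  rw [← Finset.HasAntidiagonal.mem_antidiagonal.mp hi, pow_add]
  ring

variable {L : Type*} [NontriviallyNormedField L]

theorem value_zero (h : L⟦X⟧) : value h 0 = coeff 0 h := by
  rw [value, tsum_eq_single 0]
  · simp
  · intro k hk
    simp [hk]

theorem value_X (x : L) : value (X : L⟦X⟧) x = x := by
  rw [value, tsum_eq_single 1]
  · simp
  · intro k hk
    simp [coeff_X, hk]

theorem value_C_mul (c : L) (h : L⟦X⟧) (x : L) : value (C c * h) x = c * value h x := by
  simp only [value, coeff_C_mul, mul_assoc]
  exact tsum_mul_left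

theorem convergesAt_one (x : L) : ConvergesAt (1 : L⟦X⟧) x :=
  summable_of_ne_finset_zero (s := {0}) fun k hk => by
    have : k ≠ 0 := by simpa using hk
    simp [coeff_one, this]

theorem value_one (x : L) : value (1 : L⟦X⟧) x = 1 := by
  rw [value, tsum_eq_single 0]
  · simp
  · intro k hk
    simp [coeff_one, hk]

theorem tendsto_norm_of_convergesAt {h : L⟦X⟧} {x : L} (hx : ConvergesAt h x) :
    Tendsto (fun k => ‖coeff k h‖ * ‖x‖ ^ k) atTop (𝓝 0) := by
  have := hx.tendsto_atTop_zero.norm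
  simpa using this

theorem coeff_subst_eq_tsum {p q : L⟦X⟧} (hq : coeff 0 q = 0) (n : ℕ) :
    coeff n (subst q p) = ∑' k, coeff k p * coeff n (q ^ k) := by
  have hs : HasSubst q := HasSubst.of_constantCoeff_zero' (by simpa using hq)
  rw [coeff_subst' hs, tsum_eq_finsum]
  · simp
  · exact coeff_subst_finite' hs p n

variable [IsUltrametricDist L]

theorem nonarchimedeanRing : NonarchimedeanRing L where
  is_nonarchimedean := NonarchimedeanAddGroup.is_nonarchimedean

theorem norm_value_le {h : L⟦X⟧} {x : L} {C : ℝ} (hC : 0 ≤ C)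
    (hx : ∀ k, ‖coeff k h‖ * ‖x‖ ^ k ≤ C) : ‖value h x‖ ≤ C :=
  IsUltrametricDist.norm_tsum_le_of_forall_le_of_nonneg hC fun k => by
    simpa using hx k

theorem summable_prod_mul {p q : L⟦X⟧} {x : L} (hp : ConvergesAt p x) (hq : ConvergesAt q x) :
    Summable fun i : ℕ × ℕ => (coeff i.1 p * x ^ i.1) * (coeff i.2 q * x ^ i.2) := by
  have := nonarchimedeanRing (L := L)
  exact Summable.mul_of_nonarchimedean (R := L) (f := fun k => coeff k p * x ^ k)
    (g := fun k => coeff k q * x ^ k) hp hq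

theorem ConvergesAt.mul {p q : L⟦X⟧} {x : L} (hp : ConvergesAt p x) (hq : ConvergesAt q x) :
    ConvergesAt (p * q) x := by
  have := summable_sum_mul_antidiagonal_of_summable_mul (f := fun k => coeff k p * x ^ k)
    (g := fun k => coeff k q * x ^ k) (summable_prod_mul hp hq)
  simpa only [ConvergesAt, coeff_mul_mul_pow] using this

theorem value_mul {p q : L⟦X⟧} {x : L} (hp : ConvergesAt p x) (hq : ConvergesAt q x) :
    value (p * q) x = value p x * value q x := by
  simp only [value, coeff_mul_mul_pow]
  exact (Summable.tsum_mul_tsum_eq_tsum_sum_antidiagonal (f := fun k => coeff k p * x ^ k)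
    (g := fun k => coeff k q * x ^ k) hp hq (summable_prod_mul hp hq)).symm

theorem ConvergesAt.pow {p : L⟦X⟧} {x : L} (hp : ConvergesAt p x) (n : ℕ) :
    ConvergesAt (p ^ n) x := by
  induction n with
  | zero => simpa using convergesAt_one x
  | succ n ih => rw [pow_succ]; exact ih.mul hp

theorem value_pow {p : L⟦X⟧} {x : L} (hp : ConvergesAt p x) (n : ℕ) :
    value (p ^ n) x = value p x ^ n := by
  induction n with
  | zero => simpa using value_one x
  | succ n ih => rw [pow_succ, value_mul (hp.pow n) hp, ih, pow_succ]

/-- Submultiplicativity of the Gauss norm, in a form that only looks at the first coefficients. -/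
theorem norm_coeff_mul_le {p q : L⟦X⟧} {r A B : ℝ} (hr : 0 ≤ r) (hA : 0 ≤ A) {m : ℕ}
    (hp : ∀ j ≤ m, ‖coeff j p‖ * r ^ j ≤ A) (hq : ∀ j ≤ m, ‖coeff j q‖ * r ^ j ≤ B) :
    ∀ j ≤ m, ‖coeff j (p * q)‖ * r ^ j ≤ A * B := by
  intro j hj
  rw [coeff_mul]
  obtain ⟨i, hi, hle⟩ := IsUltrametricDist.exists_norm_finsetSum_le_of_nonempty
    (Finset.nonempty_def.mpr ⟨(0, j), by simp⟩ : (Finset.HasAntidiagonal.antidiagonal j).Nonempty)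
    (fun i => coeff i.1 p * coeff i.2 q)
  have hi' := Finset.HasAntidiagonal.mem_antidiagonal.mp hi
  calc _ ≤ ‖coeff i.1 p * coeff i.2 q‖ * r ^ j := by gcongr
    _ = (‖coeff i.1 p‖ * r ^ i.1) * (‖coeff i.2 q‖ * r ^ i.2) := by
      rw [norm_mul, ← hi', pow_add]; ring
    _ ≤ A * B := mul_le_mul (hp _ (by lia)) (hq _ (by lia)) (by positivity) hA

theorem norm_coeff_pow_le {p : L⟦X⟧} {r A : ℝ} (hr : 0 ≤ r) (hA : 0 ≤ A) {m : ℕ}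
    (hp : ∀ j ≤ m, ‖coeff j p‖ * r ^ j ≤ A) (n : ℕ) :
    ∀ j ≤ m, ‖coeff j (p ^ n)‖ * r ^ j ≤ A ^ n := by
  induction n with
  | zero =>
    intro j _
    rcases eq_or_ne j 0 with rfl | h
    · simp
    · simp [coeff_one, h]
  | succ n ih =>
    rw [pow_succ, pow_succ]
    exact norm_coeff_mul_le hr (pow_nonneg hA n) ih hp

variable [CompleteSpace L]

theorem convergesAt_of_tendsto {h : L⟦X⟧} {x : L}
    (hx : Tendsto (fun k => ‖coeff k h‖ * ‖x‖ ^ k) atTop (𝓝 0)) : ConvergesAt h x := by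
  rw [ConvergesAt, NonarchimedeanAddGroup.summable_iff_tendsto_cofinite_zero,
    Nat.cofinite_eq_atTop, tendsto_zero_iff_norm_tendsto_zero]
  simpa using hx

/-- Evaluation commutes with composition of power series: if the terms of `q` at `x` are bounded by
`s` and `p` converges on the closed disc of radius `s`, then `(p ∘ q)(x) = p (q (x))`. -/
theorem value_subst {p q : L⟦X⟧} {x : L} {s : ℝ} (hq0 : coeff 0 q = 0) (hq : ConvergesAt q x)
    (hs : 0 ≤ s) (hqs : ∀ k, ‖coeff k q‖ * ‖x‖ ^ k ≤ s)
    (hp : Tendsto (fun k => ‖coeff k p‖ * s ^ k) atTop (𝓝 0)) :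
    value (subst q p) x = value p (value q x) := by
  -- The double family tends to zero: uniformly in `n` as `k` grows, and in `n` for each fixed `k`.
  have hsum : Summable (Function.uncurry fun k n : ℕ =>
      coeff k p * (coeff n (q ^ k) * x ^ n)) := by
    rw [NonarchimedeanAddGroup.summable_iff_tendsto_cofinite_zero,
      tendsto_zero_iff_norm_tendsto_zero, Metric.tendsto_nhds]
    intro ε hε
    obtain ⟨N, hN⟩ := eventually_atTop.mp (hp.eventually (gt_mem_nhds hε))
    have hn : ∀ k, ∃ M, ∀ n ≥ M, ‖coeff k p * (coeff n (q ^ k) * x ^ n)‖ < ε := fun k => by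
      have h1 : Tendsto (fun n => ‖coeff k p * (coeff n (q ^ k) * x ^ n)‖) atTop (𝓝 0) := by
        simpa using ((hq.pow k).tendsto_atTop_zero.const_mul (coeff k p)).norm
      exact eventually_atTop.mp (h1.eventually (gt_mem_nhds hε))
    choose M hM using hn
    refine ((Finset.range N).sigma fun k => Finset.range (M k)).finite_toSet.image
      (fun i : (_ : ℕ) × ℕ => (i.1, i.2)) |>.subset ?_
    rintro ⟨k, n⟩ hkn
    have hkn' : ε ≤ ‖coeff k p * (coeff n (q ^ k) * x ^ n)‖ := by
      simpa using hkn
    refine ⟨⟨k, n⟩, ?_, rfl⟩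
    simp only [Finset.coe_sigma, Set.mem_sigma_iff, Finset.mem_coe, Finset.mem_range]
    refine ⟨?_, ?_⟩
    · by_contra hk
      refine absurd hkn' (not_le.mpr (lt_of_le_of_lt ?_ (hN k (not_lt.mp hk))))
      rw [norm_mul, norm_mul, norm_pow]
      exact mul_le_mul_of_nonneg_left
        (norm_coeff_pow_le (norm_nonneg x) hs (fun j _ => hqs j) k n le_rfl) (norm_nonneg _)
    · by_contra hn
      exact absurd hkn' (not_le.mpr (hM k n (not_lt.mp hn)))
  calc value (subst q p) x = ∑' n, ∑' k, coeff k p * (coeff n (q ^ k) * x ^ n) := by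
        refine tsum_congr fun n => ?_
        rw [coeff_subst_eq_tsum hq0, ← tsum_mul_right]
        simp only [mul_assoc]
    _ = ∑' k, ∑' n, coeff k p * (coeff n (q ^ k) * x ^ n) := hsum.tsum_comm
    _ = value p (value q x) := by
        refine tsum_congr fun k => ?_
        rw [tsum_mul_left, ← value_pow hq]
        rfl

end Evaluation

/-! ### Compositional inverses -/

section Inverse

theorem eq_substInvOfIsUnit {R : Type*} [CommRing R] {g h : R⟦X⟧} (hg : constantCoeff g = 0)
    (hu : IsUnit (coeff 1 g)) (hh : constantCoeff h = 0) (hgh : subst h g = (X : R⟦X⟧)) :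
    h = g.substInvOfIsUnit hu := by
  have h1 := subst_comp_subst_apply (HasSubst.of_constantCoeff_zero' hg)
    (HasSubst.of_constantCoeff_zero' hh) (g.substInvOfIsUnit hu)
  rwa [subst_substInvOfIsUnit_left g hg hu, subst_X (HasSubst.of_constantCoeff_zero' hh), hgh,
    X_subst] at h1

variable {L : Type*} [NontriviallyNormedField L] [IsUltrametricDist L]

/-- If the coefficients of `g = x + ⋯` satisfy `|b_k| τ ^ k ≤ τ`, then so do those of the power
series inverse to `g` under composition. -/
theorem norm_coeff_inverse_le {g h : L⟦X⟧} {τ : ℝ} (hτ : 0 < τ) (hg0 : coeff 0 g = 0)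
    (hg1 : coeff 1 g = 1) (hg : ∀ k, ‖coeff k g‖ * τ ^ k ≤ τ) (hh : coeff 0 h = 0)
    (hgh : subst h g = (X : L⟦X⟧)) (n : ℕ) : ‖coeff n h‖ * τ ^ n ≤ τ := by
  obtain ⟨H, rfl⟩ : X ∣ h := X_dvd_iff.mpr (by simpa using hh)
  rcases n with _ | n
  · simpa using hτ.le
  rw [coeff_succ_X_mul]
  suffices ‖coeff n H‖ * τ ^ n ≤ 1 by
    calc ‖coeff n H‖ * τ ^ (n + 1) = (‖coeff n H‖ * τ ^ n) * τ := by ring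
      _ ≤ 1 * τ := by gcongr
      _ = τ := one_mul τ
  induction n using Nat.strong_induction_on with
  | _ n ih =>
  have hcoeff : ∀ k, coeff (n + 1) ((X * H) ^ k) =
      if k ≤ n + 1 then coeff (n + 1 - k) (H ^ k) else 0 := fun k => by
    rw [mul_pow, coeff_X_pow_mul']
  have hsumm : Summable fun k => coeff k g * coeff (n + 1) ((X * H) ^ k) :=
    summable_of_ne_finset_zero (s := Finset.range (n + 2)) fun k hk => by
      have : ¬ k ≤ n + 1 := by
        rw [Finset.mem_range] at hk
        lia
      rw [hcoeff, if_neg this, mul_zero]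
  -- Comparing the coefficients of degree `n + 1` in `g ∘ h = X` gives a recursion for `coeff n H`.
  have key := coeff_subst_eq_tsum (p := g) hh (n + 1)
  rw [hgh, hsumm.tsum_eq_add_tsum_ite 1, hg1, one_mul, pow_one, coeff_succ_X_mul] at key
  have hrec : coeff n H = coeff (n + 1) (X : L⟦X⟧) -
      ∑' k, if k = 1 then 0 else coeff k g * coeff (n + 1) ((X * H) ^ k) := by
    rw [key]; ring
  have hterm : ∀ k, ‖if k = 1 then 0 else coeff k g * coeff (n + 1) ((X * H) ^ k)‖ ≤
      (τ ^ n)⁻¹ := by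
    intro k
    rcases eq_or_ne k 1 with rfl | hk1
    · simp [hτ.le]
    rw [if_neg hk1, hcoeff]
    split_ifs with hk
    · rcases Nat.eq_zero_or_pos k with rfl | hk0
      · simp [hg0, hτ.le]
      have hpow := norm_coeff_pow_le (p := H) hτ.le zero_le_one (m := n + 1 - k)
        (fun j hj => ih j (by lia)) k _ le_rfl
      rw [one_pow] at hpow
      rw [norm_mul, ← one_div, le_div_iff₀ (pow_pos hτ n)]
      refine le_of_mul_le_mul_right ?_ hτ
      calc ‖coeff k g‖ * ‖coeff (n + 1 - k) (H ^ k)‖ * τ ^ n * τ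
          = (‖coeff k g‖ * τ ^ k) * (‖coeff (n + 1 - k) (H ^ k)‖ * τ ^ (n + 1 - k)) := by
            have : τ ^ n * τ = τ ^ k * τ ^ (n + 1 - k) := by
              rw [← pow_succ, ← pow_add]; congr 1; lia
            rw [mul_assoc _ (τ ^ n), this]; ring
        _ ≤ τ * 1 := mul_le_mul (hg k) hpow (by positivity) hτ.le
        _ = 1 * τ := mul_comm _ _
    · simp [hτ.le]
  have hX : ‖coeff (n + 1) (X : L⟦X⟧)‖ ≤ (τ ^ n)⁻¹ := by
    rcases n with _ | n
    · simp
    · simp [coeff_X, hτ.le]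
  have hle : ‖coeff n H‖ ≤ (τ ^ n)⁻¹ := by
    rw [hrec]
    rw [sub_eq_add_neg]
    refine (IsUltrametricDist.norm_add_le_max _ _).trans (max_le hX ?_)
    rw [norm_neg]
    exact IsUltrametricDist.norm_tsum_le_of_forall_le_of_nonneg (by positivity) hterm
  rwa [← one_div, le_div_iff₀ (pow_pos hτ n)] at hle

end Inverse

/-! ### Dominant indices and zeros of power series -/

section Zeros

variable {L : Type*} [NontriviallyNormedField L]

theorem lt_of_isGreatest_dominantIndices {p : L⟦X⟧} {r : ℝ} {i j : ℕ}
    (hi : IsGreatest (dominantIndices p r) i) (hj : i < j) :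
    ‖coeff j p‖ * r ^ j < ‖coeff i p‖ * r ^ i := by
  by_contra hlt
  exact absurd (hi.2 fun k => (hi.1 k).trans (not_lt.mp hlt)) (not_le.mpr hj)

theorem pos_of_isGreatest_dominantIndices {p : L⟦X⟧} {r : ℝ} (hr : 0 < r) {i : ℕ}
    (hi : IsGreatest (dominantIndices p r) i) : 0 < ‖coeff i p‖ * r ^ i :=
  lt_of_le_of_lt (by positivity) (lt_of_isGreatest_dominantIndices hi i.lt_succ_self)

theorem isGreatest_dominantIndices_of_lt {p : L⟦X⟧} {r : ℝ} {i : ℕ}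
    (hle : ∀ j, ‖coeff j p‖ * r ^ j ≤ ‖coeff i p‖ * r ^ i)
    (hlt : ∀ j, i < j → ‖coeff j p‖ * r ^ j < ‖coeff i p‖ * r ^ i) :
    IsGreatest (dominantIndices p r) i :=
  ⟨hle, fun j hj => not_lt.mp fun hij => absurd (hj i) (not_le.mpr (hlt j hij))⟩

theorem isGreatest_dominantIndices_C {c : L} (hc : c ≠ 0) (r : ℝ) :
    IsGreatest (dominantIndices (C c) r) 0 := by
  have hlt : ∀ j, 0 < j → ‖coeff j (C c)‖ * r ^ j < ‖coeff 0 (C c)‖ * r ^ 0 := fun j hj => by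
    simp [coeff_C, hj.ne', hc]
  refine isGreatest_dominantIndices_of_lt (fun j => ?_) hlt
  rcases Nat.eq_zero_or_pos j with rfl | hj
  exacts [le_rfl, (hlt j hj).le]

theorem isGreatest_dominantIndices_X_sub_C_of_le {a : L} {r : ℝ} (hr : 0 < r) (ha : ‖a‖ ≤ r) :
    IsGreatest (dominantIndices (X - C a) r) 1 := by
  have hlt : ∀ j, 1 < j → ‖coeff j (X - C a)‖ * r ^ j < ‖coeff 1 (X - C a)‖ * r ^ 1 :=
    fun j hj => by simp [coeff_X, coeff_C, hj.ne', (zero_lt_one.trans hj).ne', hr]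
  refine isGreatest_dominantIndices_of_lt (fun j => ?_) hlt
  rcases lt_trichotomy j 1 with hj | rfl | hj
  · obtain rfl : j = 0 := by lia
    simpa [coeff_X, coeff_C] using ha
  exacts [le_rfl, (hlt j hj).le]

theorem isGreatest_dominantIndices_X_sub_C_of_lt {a : L} {r : ℝ} (hr : 0 < r) (ha : r < ‖a‖) :
    IsGreatest (dominantIndices (X - C a) r) 0 := by
  have hlt : ∀ j, 0 < j → ‖coeff j (X - C a)‖ * r ^ j < ‖coeff 0 (X - C a)‖ * r ^ 0 := by
    intro j hj
    rcases eq_or_ne j 1 with rfl | hj1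
    · simpa [coeff_X, coeff_C] using ha
    · simp only [map_sub, coeff_X, coeff_C, hj1, hj.ne', if_false, sub_self, norm_zero, zero_mul]
      simpa using hr.trans ha
  refine isGreatest_dominantIndices_of_lt (fun j => ?_) hlt
  rcases Nat.eq_zero_or_pos j with rfl | hj
  exacts [le_rfl, (hlt j hj).le]

theorem eval_trunc (q : L⟦X⟧) (N : ℕ) (x : L) :
    (trunc N q).eval x = ∑ i ∈ Finset.range N, coeff i q * x ^ i := by
  simpa using eval₂_trunc_eq_sum_range x (RingHom.id L) N q

theorem tendsto_eval_trunc {q : L⟦X⟧} {x : L} (hx : ConvergesAt q x) :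
    Tendsto (fun N => (trunc N q).eval x) atTop (𝓝 (value q x)) := by
  simp only [eval_trunc]
  exact hx.hasSum.tendsto_sum_nat

theorem exists_norm_sub_pow_card_le_prod (S : Multiset L) (hS : S ≠ 0) (x : L) :
    ∃ s ∈ S, ‖x - s‖ ^ S.card ≤ (S.map fun s => ‖x - s‖).prod := by
  induction S using Multiset.induction_on with
  | empty => exact absurd rfl hS
  | cons a S ih =>
    rcases eq_or_ne S 0 with rfl | hS0
    · exact ⟨a, by simp, by simp⟩
    obtain ⟨s, hs, hle⟩ := ih hS0
    rw [Multiset.map_cons, Multiset.prod_cons, Multiset.card_cons]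
    rcases le_total ‖x - a‖ ‖x - s‖ with h | h
    · refine ⟨a, by simp, ?_⟩
      rw [pow_succ']
      gcongr
      exact (pow_le_pow_left₀ (norm_nonneg _) h _).trans hle
    · refine ⟨s, by simp [hs], ?_⟩
      rw [pow_succ']
      gcongr

theorem prod_norm_sub_le (S : Multiset L) {x : L} {r : ℝ}
    (hS : ∀ s ∈ S, ‖x - s‖ ≤ r) : (S.map fun s => ‖x - s‖).prod ≤ r ^ S.card := by
  induction S using Multiset.induction_on with
  | empty => simp
  | cons a S ih =>
    rw [Multiset.map_cons, Multiset.prod_cons, Multiset.card_cons, pow_succ']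
    have ha := hS a (by simp)
    have h := ih fun s hs => hS s (by simp [hs])
    exact mul_le_mul ha h (Multiset.prod_nonneg (by simp)) ((norm_nonneg _).trans ha)

variable [IsUltrametricDist L]

/-- Largest dominant indices add up under multiplication; this is the multiplicativity of the
Weierstrass degree and of the Gauss norm. -/
theorem isGreatest_dominantIndices_mul {p q : L⟦X⟧} {r : ℝ} (hr : 0 < r) {i j : ℕ}
    (hi : IsGreatest (dominantIndices p r) i) (hj : IsGreatest (dominantIndices q r) j) :
    IsGreatest (dominantIndices (p * q) r) (i + j) ∧
      ‖coeff (i + j) (p * q)‖ = ‖coeff i p‖ * ‖coeff j q‖ := by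
  have hA := pos_of_isGreatest_dominantIndices hr hi
  have hB := pos_of_isGreatest_dominantIndices hr hj
  set A := ‖coeff i p‖ * r ^ i with hAdef
  set B := ‖coeff j q‖ * r ^ j with hBdef
  have hAB : 0 < A * B := mul_pos hA hB
  have hAB' : A * B = ‖coeff i p‖ * ‖coeff j q‖ * r ^ (i + j) := by
    rw [hAdef, hBdef, pow_add]; ring
  have hterm : ∀ u v, i < u ∨ j < v → ‖coeff u p * coeff v q‖ * r ^ (u + v) < A * B := by
    intro u v huv
    have h : ‖coeff u p * coeff v q‖ * r ^ (u + v) =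
        (‖coeff u p‖ * r ^ u) * (‖coeff v q‖ * r ^ v) := by
      rw [norm_mul, pow_add]; ring
    rw [h]
    rcases huv with hu | hv
    · exact mul_lt_mul_of_nonneg_of_pos (lt_of_isGreatest_dominantIndices hi hu) (hj.1 v)
        (by positivity) hB
    · exact mul_lt_mul_of_nonneg_of_pos' (hi.1 u) (lt_of_isGreatest_dominantIndices hj hv)
        (by positivity) hA
  -- A sum of terms of the Cauchy product that avoids the index `(i, j)` is strictly dominated.
  have hsum : ∀ (n : ℕ) (s : Finset (ℕ × ℕ)),
      (∀ uv ∈ s, uv.1 + uv.2 = n ∧ (i < uv.1 ∨ j < uv.2)) →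
      ‖∑ uv ∈ s, coeff uv.1 p * coeff uv.2 q‖ * r ^ n < A * B := by
    intro n s hs
    rcases s.eq_empty_or_nonempty with rfl | hne
    · simpa using hAB
    obtain ⟨uv, huv, hle⟩ := IsUltrametricDist.exists_norm_finsetSum_le_of_nonempty hne
      (fun uv : ℕ × ℕ => coeff uv.1 p * coeff uv.2 q)
    refine lt_of_le_of_lt ?_ (hterm uv.1 uv.2 (hs uv huv).2)
    rw [(hs uv huv).1]
    gcongr
  have hnorm : ‖coeff (i + j) (p * q)‖ = ‖coeff i p‖ * ‖coeff j q‖ := by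
    have hmem : ((i, j) : ℕ × ℕ) ∈ Finset.HasAntidiagonal.antidiagonal (i + j) := by simp
    have hrest := hsum (i + j) ((Finset.HasAntidiagonal.antidiagonal (i + j)).erase (i, j)) (by
      rintro ⟨u, v⟩ huv
      rw [Finset.mem_erase, Finset.HasAntidiagonal.mem_antidiagonal] at huv
      refine ⟨huv.2, ?_⟩
      by_contra hcon
      have h1 : u + v = i + j := huv.2
      simp only [not_or, not_lt] at hcon
      exact huv.1 (by ext <;> simp <;> lia))
    rw [hAB', mul_lt_mul_iff_left₀ (pow_pos hr _), ← norm_mul] at hrest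
    rw [coeff_mul, ← Finset.add_sum_erase _ _ hmem,
      IsUltrametricDist.norm_add_eq_max_of_norm_ne_norm hrest.ne', max_eq_left hrest.le, norm_mul]
  have hval : ‖coeff (i + j) (p * q)‖ * r ^ (i + j) = A * B := by rw [hnorm, hAB']
  refine ⟨isGreatest_dominantIndices_of_lt (fun n => ?_) fun n hn => ?_, hnorm⟩
  · rw [hval]
    exact norm_coeff_mul_le hr.le hA.le (fun k _ => hi.1 k) (fun k _ => hj.1 k) n le_rfl
  · rw [hval, coeff_mul]
    refine hsum n _ fun uv huv => ?_
    rw [Finset.HasAntidiagonal.mem_antidiagonal] at huv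
    exact ⟨huv, by lia⟩

/-- A product of linear factors on a closed disc: the factors `X - a` with `|a| ≤ r` raise the largest
dominant index by one, and the others have constant absolute value on the disc. -/
theorem exists_factorization_aux {c : L} (hc : c ≠ 0) {r : ℝ} (hr : 0 < r) (M : Multiset L) :
    ∃ (p : L⟦X⟧) (S : Multiset L),
      p = ((Polynomial.C c * (M.map fun a => Polynomial.X - Polynomial.C a).prod :
        Polynomial L) : L⟦X⟧) ∧
      IsGreatest (dominantIndices p r) S.card ∧ (∀ s ∈ S, ‖s‖ ≤ r) ∧
      ∀ x : L, ‖x‖ ≤ r →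
        ‖(Polynomial.C c * (M.map fun a => Polynomial.X - Polynomial.C a).prod).eval x‖ =
          ‖coeff S.card p‖ * (S.map fun s => ‖x - s‖).prod := by
  induction M using Multiset.induction_on with
  | empty =>
    exact ⟨C c, 0, by simp, isGreatest_dominantIndices_C hc r, by simp, by simp⟩
  | cons a M ih =>
    obtain ⟨p, S, hp, hdom, hS, hev⟩ := ih
    have hpoly : (Polynomial.C c * ((a ::ₘ M).map fun a => Polynomial.X - Polynomial.C a).prod :
        Polynomial L) = (Polynomial.C c * (M.map fun a => Polynomial.X - Polynomial.C a).prod) *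
          (Polynomial.X - Polynomial.C a) := by
      rw [Multiset.map_cons, Multiset.prod_cons]; ring
    have hcoe : ((Polynomial.C c * ((a ::ₘ M).map fun a => Polynomial.X - Polynomial.C a).prod :
        Polynomial L) : L⟦X⟧) = p * (X - C a) := by
      rw [hpoly, Polynomial.coe_mul, ← hp, Polynomial.coe_sub, Polynomial.coe_X, Polynomial.coe_C]
    rcases le_or_gt ‖a‖ r with ha | ha
    · obtain ⟨h1, h2⟩ := isGreatest_dominantIndices_mul hr hdom
        (isGreatest_dominantIndices_X_sub_C_of_le hr ha)
      refine ⟨p * (X - C a), a ::ₘ S, hcoe.symm, by simpa using h1, by simpa [ha] using hS,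
        fun x hx => ?_⟩
      rw [Multiset.card_cons, h2, hpoly, Polynomial.eval_mul, norm_mul, hev x hx]
      simp [coeff_X]
      ring
    · obtain ⟨h1, h2⟩ := isGreatest_dominantIndices_mul hr hdom
        (isGreatest_dominantIndices_X_sub_C_of_lt hr ha)
      rw [add_zero] at h1 h2
      refine ⟨p * (X - C a), S, hcoe.symm, h1, hS, fun x hx => ?_⟩
      have hxa : ‖x - a‖ = ‖a‖ := by
        have hlt : ‖x‖ < ‖-a‖ := by simpa using hx.trans_lt ha
        rw [sub_eq_add_neg, IsUltrametricDist.norm_add_eq_max_of_norm_ne_norm hlt.ne,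
          max_eq_right hlt.le, norm_neg]
      rw [h2, hpoly, Polynomial.eval_mul, norm_mul, hev x hx]
      simp [hxa]
      ring

/-- If `m` is the largest dominant index of a split polynomial `P` at `r`, then `P` has `m` roots in
the closed disc of radius `r`, and on that disc the other roots contribute a constant to `|P|`. -/
theorem exists_factorization {P : Polynomial L} (hP : P.Splits) {r : ℝ} (hr : 0 < r) {m : ℕ}
    (hm : IsGreatest (dominantIndices (P : L⟦X⟧) r) m) :
    ∃ S : Multiset L, S.card = m ∧ (∀ s ∈ S, ‖s‖ ≤ r) ∧ ∀ x : L, ‖x‖ ≤ r →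
      ‖P.eval x‖ = ‖P.coeff m‖ * (S.map fun s => ‖x - s‖).prod := by
  have hP0 : P ≠ 0 := by
    rintro rfl
    simpa using pos_of_isGreatest_dominantIndices hr hm
  obtain ⟨p, S, hp, hdom, hS, hev⟩ :=
    exists_factorization_aux (Polynomial.leadingCoeff_ne_zero.mpr hP0) hr P.roots
  rw [← hP.eq_prod_roots] at hp hev
  subst hp
  obtain rfl := hdom.unique hm
  exact ⟨S, rfl, hS, by simpa using hev⟩

/-- The factorization of the truncations of a power series over its zeros in a closed disc. -/
theorem exists_factorization_trunc {q : L⟦X⟧} (hsplit : ∀ N, (trunc N q).Splits) {r : ℝ}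
    (hr : 0 < r) {m : ℕ} (hm : IsGreatest (dominantIndices q r) m) {N : ℕ} (hN : m < N) :
    ∃ S : Multiset L, S.card = m ∧ (∀ s ∈ S, ‖s‖ ≤ r) ∧ ∀ x : L, ‖x‖ ≤ r →
      ‖(trunc N q).eval x‖ = ‖coeff m q‖ * (S.map fun s => ‖x - s‖).prod := by
  have hpos := pos_of_isGreatest_dominantIndices hr hm
  have hdom : IsGreatest (dominantIndices (trunc N q : L⟦X⟧) r) m := by
    refine isGreatest_dominantIndices_of_lt (fun j => ?_) fun j hj => ?_ <;>
      simp only [Polynomial.coeff_coe, coeff_trunc, if_pos hN] <;> split_ifs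
    · exact hm.1 j
    · simpa using hpos.le
    · exact lt_of_isGreatest_dominantIndices hm hj
    · simpa using hpos
  obtain ⟨S, h1, h2, h3⟩ := exists_factorization (hsplit N) hr hdom
  exact ⟨S, h1, h2, by simpa [coeff_trunc, hN] using h3⟩

variable [CompleteSpace L]

/-- A power series of positive Weierstrass degree on a closed disc has a zero there, provided its
truncations split: follow the roots of the truncations. -/
theorem exists_value_eq_zero {q : L⟦X⟧} (hsplit : ∀ N, (trunc N q).Splits) {r : ℝ} (hr : 0 < r)
    {m : ℕ} (hm : IsGreatest (dominantIndices q r) m) (hm0 : m ≠ 0)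
    (hq : Tendsto (fun k => ‖coeff k q‖ * r ^ k) atTop (𝓝 0)) :
    ∃ x : L, ‖x‖ ≤ r ∧ value q x = 0 := by
  have hpos : 0 < ‖coeff m q‖ :=
    pos_of_mul_pos_left (pos_of_isGreatest_dominantIndices hr hm) (pow_nonneg hr.le m)
  let R : ℕ → Set L := fun n => {x | ‖x‖ ≤ r ∧ (trunc (m + 1 + n) q).eval x = 0}
  have hfac := fun n : ℕ => exists_factorization_trunc hsplit hr hm (N := m + 1 + n) (by lia)
  choose S hcard hS hev using hfac
  have hne : ∀ n, S n ≠ 0 := fun n h => hm0 (by rw [← hcard n, h, Multiset.card_zero])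
  have hmemR : ∀ n, ∀ s ∈ S n, s ∈ R n := fun n s hs => by
    refine ⟨hS n s hs, norm_eq_zero.mp ?_⟩
    rw [hev n s (hS n s hs), Multiset.prod_eq_zero, mul_zero]
    exact Multiset.mem_map.mpr ⟨s, hs, by simp⟩
  have hmemS : ∀ n, ∀ x ∈ R n, x ∈ S n := fun n x hx => by
    have h0 := hev n x hx.1
    rw [hx.2, norm_zero, eq_comm, mul_eq_zero, Multiset.prod_eq_zero_iff, Multiset.mem_map] at h0
    obtain ⟨s, hs, hxs⟩ := h0.resolve_left hpos.ne'
    rwa [sub_eq_zero.mp (norm_eq_zero.mp hxs)]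
  -- A root of one truncation almost annihilates the next one, hence is close to one of its roots.
  have hstep : ∀ n, ∀ x : R n, ∃ y : R (n + 1),
      ‖coeff m q‖ * ‖(y : L) - x‖ ^ m ≤ ‖coeff (m + 1 + n) q‖ * r ^ (m + 1 + n) := by
    rintro n ⟨x, hx, hx0⟩
    obtain ⟨s, hs, hle⟩ := exists_norm_sub_pow_card_le_prod (S (n + 1)) (hne _) x
    refine ⟨⟨s, hmemR _ s hs⟩, ?_⟩
    rw [hcard] at hle
    calc ‖coeff m q‖ * ‖s - x‖ ^ m
        ≤ ‖coeff m q‖ * ((S (n + 1)).map fun s => ‖x - s‖).prod := by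
          rw [norm_sub_rev]; gcongr
      _ = ‖(trunc (m + 1 + (n + 1)) q).eval x‖ := (hev (n + 1) x hx).symm
      _ = ‖coeff (m + 1 + n) q * x ^ (m + 1 + n)‖ := by
          rw [eval_trunc, ← add_assoc, Finset.sum_range_succ, ← eval_trunc, hx0, zero_add]
      _ ≤ _ := by
          rw [norm_mul, norm_pow]; gcongr
  choose next hnext using hstep
  obtain ⟨s0, hs0⟩ := Multiset.exists_mem_of_ne_zero (hne 0)
  obtain ⟨u, hrec⟩ : ∃ u : (n : ℕ) → R n, ∀ n, u (n + 1) = next n (u n) :=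
    ⟨Nat.rec ⟨s0, hmemR 0 s0 hs0⟩ next, fun _ => rfl⟩
  have hu : ∀ n, ‖coeff m q‖ * ‖((u (n + 1) : R (n + 1)) : L) - ((u n : R n) : L)‖ ^ m ≤
      ‖coeff (m + 1 + n) q‖ * r ^ (m + 1 + n) := fun n => by
    rw [hrec n]
    exact hnext n (u n)
  have hcauchy : CauchySeq fun n => (u n : L) := by
    apply NonarchimedeanAddGroup.cauchySeq_of_tendsto_sub_nhds_zero
    rw [tendsto_zero_iff_norm_tendsto_zero, Metric.tendsto_nhds]
    intro ε hε
    have hq' : Tendsto (fun n => ‖coeff (m + 1 + n) q‖ * r ^ (m + 1 + n)) atTop (𝓝 0) :=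
      hq.comp (tendsto_add_atTop_nat (m + 1) |>.congr fun n => add_comm _ _)
    filter_upwards [hq'.eventually (gt_mem_nhds (mul_pos hpos (pow_pos hε m)))] with n hn
    rw [dist_zero_right, norm_norm]
    exact lt_of_pow_lt_pow_left₀ m hε.le (lt_of_mul_lt_mul_left ((hu n).trans_lt hn) hpos.le)
  obtain ⟨x, hx⟩ := cauchySeq_tendsto_of_complete hcauchy
  have hxr : ‖x‖ ≤ r := le_of_tendsto' hx.norm fun n => (u n).2.1
  have hconv : ConvergesAt q x := convergesAt_of_tendsto
    (tendsto_mul_pow_of_le (fun _ => norm_nonneg _) (norm_nonneg _) hxr hq)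
  refine ⟨x, hxr, ?_⟩
  have h1 : Tendsto (fun n => (trunc (m + 1 + n) q).eval x) atTop (𝓝 (value q x)) :=
    (tendsto_eval_trunc hconv).comp
      (tendsto_add_atTop_nat (m + 1) |>.congr fun n => add_comm _ _)
  have h2 : Tendsto (fun n => (trunc (m + 1 + n) q).eval x) atTop (𝓝 0) := by
    rw [tendsto_zero_iff_norm_tendsto_zero]
    have hlim : Tendsto (fun n => ‖coeff m q‖ * (‖x - u n‖ * r ^ (m - 1))) atTop (𝓝 0) := by
      simpa using (((tendsto_const_nhds (x := x)).sub hx).norm.mul_const (r ^ (m - 1))).const_mul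
        ‖coeff m q‖
    refine squeeze_zero (fun _ => norm_nonneg _) (fun n => ?_) hlim
    rw [hev n x hxr]
    obtain ⟨T, hT⟩ := Multiset.exists_cons_of_mem (hmemS n _ (u n).2)
    have hTcard : T.card = m - 1 := by
      have := hcard n
      rw [hT, Multiset.card_cons] at this
      lia
    rw [hT, Multiset.map_cons, Multiset.prod_cons, ← hTcard]
    gcongr
    refine prod_norm_sub_le T fun s hs => ?_
    rw [sub_eq_add_neg]
    refine (IsUltrametricDist.norm_add_le_max _ _).trans (max_le hxr ?_)
    rw [norm_neg]
    exact hS n s (by rw [hT]; exact Multiset.mem_cons_of_mem hs)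
  exact tendsto_nhds_unique h1 h2

/-- A power series of Weierstrass degree `m` on a closed disc has at most `m` zeros there, provided
its truncations split: distinct zeros lie close to distinct roots of a truncation. -/
theorem card_le_of_value_eq_zero {q : L⟦X⟧} (hsplit : ∀ N, (trunc N q).Splits) {r : ℝ} (hr : 0 < r)
    {m : ℕ} (hm : IsGreatest (dominantIndices q r) m)
    (hq : Tendsto (fun k => ‖coeff k q‖ * r ^ k) atTop (𝓝 0))
    (Z : Finset L) (hZ : ∀ z ∈ Z, ‖z‖ ≤ r ∧ value q z = 0) : Z.card ≤ m := by
  classical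
  have hpos : 0 < ‖coeff m q‖ :=
    pos_of_mul_pos_left (pos_of_isGreatest_dominantIndices hr hm) (pow_nonneg hr.le m)
  -- The distinct points of `Z` are more than `δ` apart.
  obtain ⟨δ, hδZ, hδ⟩ : ∃ δ : ℝ, (∀ z ∈ Z.offDiag, δ < ‖z.1 - z.2‖) ∧ 0 < δ := by
    have h : ∀ᶠ δ : ℝ in 𝓝[>] 0, ∀ z ∈ Z.offDiag, δ < ‖z.1 - z.2‖ := by
      refine (Filter.eventually_all_finset _).mpr fun z hz => ?_
      have hne : z.1 - z.2 ≠ 0 := sub_ne_zero.mpr (Finset.mem_offDiag.mp hz).2.2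
      exact nhdsWithin_le_nhds (gt_mem_nhds (norm_pos_iff.mpr hne))
    exact (h.and self_mem_nhdsWithin).exists
  have hsmall : ∀ᶠ N in atTop, ∀ z ∈ Z, ‖(trunc N q).eval z‖ < ‖coeff m q‖ * δ ^ m := by
    refine (Filter.eventually_all_finset _).mpr fun z hz => ?_
    have hconv : ConvergesAt q z := convergesAt_of_tendsto
      (tendsto_mul_pow_of_le (fun _ => norm_nonneg _) (norm_nonneg _) (hZ z hz).1 hq)
    have hlim := (tendsto_eval_trunc hconv).norm
    rw [(hZ z hz).2, norm_zero] at hlim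
    exact hlim.eventually (gt_mem_nhds (by positivity))
  obtain ⟨N, hN, hmN⟩ := (hsmall.and (eventually_gt_atTop m)).exists
  obtain ⟨S, hcard, hS, hev⟩ := exists_factorization_trunc hsplit hr hm hmN
  have hnear : ∀ z ∈ Z, ∃ s ∈ S, ‖z - s‖ < δ := by
    intro z hz
    have hlt := hN z hz
    rw [hev z (hZ z hz).1, mul_lt_mul_iff_right₀ hpos] at hlt
    rcases eq_or_ne S 0 with rfl | hS0
    · rw [← hcard] at hlt
      simp at hlt
    obtain ⟨s, hs, hle⟩ := exists_norm_sub_pow_card_le_prod S hS0 z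
    rw [hcard] at hle
    exact ⟨s, hs, lt_of_pow_lt_pow_left₀ m hδ.le (hle.trans_lt hlt)⟩
  choose! root hroot hdist using hnear
  by_contra hcon
  have hlt : S.toFinset.card < Z.card :=
    (S.toFinset_card_le.trans hcard.le).trans_lt (not_le.mp hcon)
  obtain ⟨z, hz, w, hw, hzw, heq⟩ := Finset.exists_ne_map_eq_of_card_lt_of_maps_to hlt
    (f := root) (fun z hz => by simpa using hroot z hz)
  refine absurd (hδZ (z, w) (Finset.mem_offDiag.mpr ⟨hz, hw, hzw⟩)) (not_lt.mpr ?_)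
  have hsub : z - w = (z - root z) + -(w - root w) := by rw [heq]; ring
  change ‖z - w‖ ≤ δ
  rw [hsub]
  refine (IsUltrametricDist.norm_add_le_max _ _).trans (max_le (hdist z hz).le ?_)
  rw [norm_neg]
  exact (hdist w hw).le

end Zeros

/-! ### Dynamics near an indifferent fixed point -/

section Dynamics

theorem exists_gt_mul_lt_one {a r : ℝ} (hr : a * r < 1) : ∃ ρ, r < ρ ∧ a * ρ < 1 := by
  have h : ∀ᶠ ρ in 𝓝[>] r, a * ρ < 1 :=
    nhdsWithin_le_nhds ((continuous_const_mul a).continuousAt.eventually (gt_mem_nhds hr))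
  obtain ⟨ρ, h1, h2⟩ := (h.and self_mem_nhdsWithin).exists
  exact ⟨ρ, h2, h1⟩

variable {L : Type*} [NontriviallyNormedField L]

/-- The power series `f = λ x + ∑ a_i x ^ i` has an indifferent fixed point at `0`, that is
`|λ| = 1`, and its coefficients satisfy `|a_i| ≤ a ^ (i - 1)`. -/
structure IsIndifferentSeries (f : L⟦X⟧) (a : ℝ) : Prop where
  coeff_zero : coeff 0 f = 0
  norm_coeff_one : ‖coeff 1 f‖ = 1
  nonneg : 0 ≤ a
  norm_coeff_succ_le : ∀ k, ‖coeff (k + 1) f‖ ≤ a ^ k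

/-- The series has no constant term and maps the disc of radius `τ` into itself term by term. -/
structure IsSelfBounded (p : L⟦X⟧) (τ : ℝ) : Prop where
  coeff_zero : coeff 0 p = 0
  norm_le : ∀ k, ‖coeff k p‖ * τ ^ k ≤ τ

theorem isIndifferentSeries_of_isLUB {f : L⟦X⟧} {a : ℝ}
    (hf0 : coeff 0 f = 0) (hf1 : ‖coeff 1 f‖ = 1)
    (ha : IsLUB {s : ℝ | ∃ i : ℕ, 2 ≤ i ∧ s = ‖coeff i f‖ ^ (1 / ((i : ℝ) - 1))} a) :
    IsIndifferentSeries f a where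
  coeff_zero := hf0
  norm_coeff_one := hf1
  nonneg := (Real.rpow_nonneg (norm_nonneg _) _).trans (ha.1 ⟨2, le_rfl, rfl⟩)
  norm_coeff_succ_le k := by
    rcases k with _ | k
    · simp [hf1]
    have h := ha.1 ⟨k + 1 + 1, by lia, rfl⟩
    have hexp : 1 / (((k + 1 + 1 : ℕ) : ℝ) - 1) = ((k + 1 : ℕ) : ℝ)⁻¹ := by
      push_cast
      rw [one_div]
      congr 1
      ring
    rw [hexp] at h
    calc ‖coeff (k + 1 + 1) f‖ = (‖coeff (k + 1 + 1) f‖ ^ ((k + 1 : ℕ) : ℝ)⁻¹) ^ (k + 1) :=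
          (Real.rpow_inv_natCast_pow (norm_nonneg _) (by lia)).symm
      _ ≤ a ^ (k + 1) := by gcongr

theorem IsIndifferentSeries.isSelfBounded {f : L⟦X⟧} {a ρ : ℝ} (hf : IsIndifferentSeries f a)
    (hρ : 0 ≤ ρ) (haρ : a * ρ ≤ 1) : IsSelfBounded f ρ where
  coeff_zero := hf.coeff_zero
  norm_le := by
    rintro (_ | k)
    · simpa [← coeff_zero_eq_constantCoeff_apply, hf.coeff_zero] using hρ
    · calc ‖coeff (k + 1) f‖ * ρ ^ (k + 1) ≤ a ^ k * ρ ^ (k + 1) := by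
            gcongr
            exact hf.norm_coeff_succ_le k
        _ = (a * ρ) ^ k * ρ := by ring
        _ ≤ 1 * ρ := by
            gcongr
            exact pow_le_one₀ (mul_nonneg hf.nonneg hρ) haρ
        _ = ρ := one_mul ρ

theorem IsSelfBounded.norm_le_norm {p : L⟦X⟧} {τ : ℝ} (hτ : 0 < τ) (hp : IsSelfBounded p τ) {x : L}
    (hx : ‖x‖ ≤ τ) (k : ℕ) : ‖coeff k p‖ * ‖x‖ ^ k ≤ ‖x‖ := by
  rcases k with _ | k
  · rw [hp.coeff_zero]
    simp
  · have h : ‖coeff (k + 1) p‖ * τ ^ k ≤ 1 := by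
      refine le_of_mul_le_mul_right ?_ hτ
      have := hp.norm_le (k + 1)
      rwa [one_mul, mul_assoc, ← pow_succ]
    calc ‖coeff (k + 1) p‖ * ‖x‖ ^ (k + 1) = (‖coeff (k + 1) p‖ * ‖x‖ ^ k) * ‖x‖ := by ring
      _ ≤ (‖coeff (k + 1) p‖ * τ ^ k) * ‖x‖ := by gcongr
      _ ≤ 1 * ‖x‖ := by gcongr
      _ = ‖x‖ := one_mul _

theorem IsSelfBounded.tendsto {p : L⟦X⟧} {τ : ℝ} (hτ : 0 < τ) (hp : IsSelfBounded p τ) {s : ℝ}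
    (hs : 0 ≤ s) (hsτ : s < τ) : Tendsto (fun k => ‖coeff k p‖ * s ^ k) atTop (𝓝 0) := by
  have hlim : Tendsto (fun k => τ * (s / τ) ^ k) atTop (𝓝 0) := by
    simpa using (tendsto_pow_atTop_nhds_zero_of_lt_one (div_nonneg hs hτ.le)
      ((div_lt_one hτ).mpr hsτ)).const_mul τ
  refine squeeze_zero (fun k => by positivity) (fun k => ?_) hlim
  calc ‖coeff k p‖ * s ^ k = (‖coeff k p‖ * τ ^ k) * (s / τ) ^ k := by
        rw [mul_assoc, ← mul_pow, mul_div_cancel₀ _ hτ.ne']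
    _ ≤ τ * (s / τ) ^ k := by
        gcongr
        exact hp.norm_le k

theorem IsIndifferentSeries.differentiableAt [CompleteSpace L] {f : L⟦X⟧} {a : ℝ}
    (hf : IsIndifferentSeries f a) {x : L} (hx : a * ‖x‖ < 1) : DifferentiableAt L (value f) x := by
  obtain ⟨ρ, hxρ, haρ⟩ := exists_gt_mul_lt_one hx
  have hρ : 0 ≤ ρ := (norm_nonneg x).trans hxρ.le
  lift ρ to NNReal using hρ
  let p := FormalMultilinearSeries.ofScalars L fun k => coeff k f
  have hrad : (ρ : ENNReal) ≤ p.radius := by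
    refine p.le_radius_of_bound ρ fun n => ?_
    simpa [p] using! (hf.isSelfBounded ρ.2 haρ.le).norm_le n
  have hsum : p.sum = value f := by
    funext y
    exact (FormalMultilinearSeries.ofScalars_sum_eq _ y).trans (by simp [value])
  have hxball : x ∈ Metric.eball (0 : L) p.radius := by
    refine Metric.eball_subset_eball hrad ?_
    rw [Metric.mem_eball, edist_zero_right]
    exact_mod_cast (show ‖x‖₊ < ρ from hxρ)
  have hpos : 0 < p.radius := lt_of_le_of_lt zero_le hxball
  rw [← hsum]
  exact ((p.hasFPowerSeriesOnBall hpos).analyticAt_of_mem hxball).differentiableAt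

variable [IsUltrametricDist L]

theorem IsSelfBounded.norm_value_le {p : L⟦X⟧} {τ : ℝ} (hτ : 0 < τ) (hp : IsSelfBounded p τ) {x : L}
    (hx : ‖x‖ ≤ τ) : ‖value p x‖ ≤ ‖x‖ :=
  NonArch.norm_value_le (norm_nonneg x) (hp.norm_le_norm hτ hx)

theorem norm_pow_sub_pow_le {x y : L} {ρ : ℝ} (hx : ‖x‖ ≤ ρ) (hy : ‖y‖ ≤ ρ) (k : ℕ) :
    ‖x ^ (k + 1) - y ^ (k + 1)‖ ≤ ‖x - y‖ * ρ ^ k := by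
  have hρ : 0 ≤ ρ := (norm_nonneg x).trans hx
  rw [← (Commute.all x y).mul_geom_sum₂, norm_mul]
  gcongr
  refine IsUltrametricDist.norm_sum_le_of_forall_le_of_nonneg (by positivity) fun i hi => ?_
  rw [norm_mul, norm_pow, norm_pow]
  calc ‖x‖ ^ i * ‖y‖ ^ (k + 1 - 1 - i) ≤ ρ ^ i * ρ ^ (k + 1 - 1 - i) := by gcongr
    _ = ρ ^ k := by
      rw [← pow_add]
      congr 1
      have := Finset.mem_range.mp hi
      lia

variable [CompleteSpace L]

theorem IsIndifferentSeries.convergesAt {f : L⟦X⟧} {a : ℝ} (hf : IsIndifferentSeries f a) {x : L}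
    (hx : a * ‖x‖ < 1) : ConvergesAt f x := by
  refine convergesAt_of_tendsto ((tendsto_add_atTop_iff_nat 1).mp ?_)
  have hlim : Tendsto (fun k => (a * ‖x‖) ^ k * ‖x‖) atTop (𝓝 0) := by
    simpa using (tendsto_pow_atTop_nhds_zero_of_lt_one
      (mul_nonneg hf.nonneg (norm_nonneg x)) hx).mul_const ‖x‖
  refine squeeze_zero (fun k => by positivity) (fun k => ?_) hlim
  calc ‖coeff (k + 1) f‖ * ‖x‖ ^ (k + 1) ≤ a ^ k * ‖x‖ ^ (k + 1) := by
        gcongr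
        exact hf.norm_coeff_succ_le k
    _ = (a * ‖x‖) ^ k * ‖x‖ := by ring

/-- On a disc of radius less than `1 / a` the linear term dominates, so `f` is an isometry. -/
theorem IsIndifferentSeries.norm_value_sub {f : L⟦X⟧} {a ρ : ℝ} (hf : IsIndifferentSeries f a)
    (haρ : a * ρ < 1) {x y : L} (hx : ‖x‖ ≤ ρ) (hy : ‖y‖ ≤ ρ) :
    ‖value f x - value f y‖ = ‖x - y‖ := by
  rcases eq_or_ne x y with rfl | hxy
  · simp
  have hpos : 0 < ‖x - y‖ := norm_pos_iff.mpr (sub_ne_zero.mpr hxy)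
  have hρ : 0 ≤ ρ := (norm_nonneg x).trans hx
  have hfx := hf.convergesAt ((mul_le_mul_of_nonneg_left hx hf.nonneg).trans_lt haρ)
  have hfy := hf.convergesAt ((mul_le_mul_of_nonneg_left hy hf.nonneg).trans_lt haρ)
  have hsum : Summable fun k => coeff k f * x ^ k - coeff k f * y ^ k := hfx.sub hfy
  have hval : value f x - value f y = coeff 1 f * (x - y) +
      ∑' k, if k = 1 then 0 else coeff k f * x ^ k - coeff k f * y ^ k := by
    have := hsum.tsum_eq_add_tsum_ite 1
    rw [hfx.tsum_sub hfy] at this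
    rw [value, value, this]
    ring
  have hrest : ‖∑' k, if k = 1 then 0 else coeff k f * x ^ k - coeff k f * y ^ k‖ ≤
      a * ρ * ‖x - y‖ := by
    have haρ0 := mul_nonneg hf.nonneg hρ
    refine IsUltrametricDist.norm_tsum_le_of_forall_le_of_nonneg (by positivity) fun k => ?_
    rcases k with _ | _ | k
    · simpa using by positivity
    · simpa using by positivity
    · rw [if_neg (by lia), ← mul_sub, norm_mul]
      calc ‖coeff (k + 1 + 1) f‖ * ‖x ^ (k + 1 + 1) - y ^ (k + 1 + 1)‖
          ≤ a ^ (k + 1) * (‖x - y‖ * ρ ^ (k + 1)) :=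
            mul_le_mul (hf.norm_coeff_succ_le _) (norm_pow_sub_pow_le hx hy _) (norm_nonneg _)
              (pow_nonneg hf.nonneg _)
        _ = (a * ρ) ^ k * (a * ρ * ‖x - y‖) := by ring
        _ ≤ 1 * (a * ρ * ‖x - y‖) := by
            gcongr
            exact pow_le_one₀ haρ0 haρ.le
        _ = a * ρ * ‖x - y‖ := one_mul _
  have hlin : ‖coeff 1 f * (x - y)‖ = ‖x - y‖ := by rw [norm_mul, hf.norm_coeff_one, one_mul]
  have hlt := hrest.trans_lt (mul_lt_of_lt_one_left hpos haρ)
  rw [← hlin] at hlt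
  rw [hval, IsUltrametricDist.norm_add_eq_max_of_norm_ne_norm hlt.ne', max_eq_left hlt.le, hlin]

theorem IsIndifferentSeries.norm_value {f : L⟦X⟧} {a : ℝ} (hf : IsIndifferentSeries f a) {x : L}
    (hx : a * ‖x‖ < 1) : ‖value f x‖ = ‖x‖ := by
  have := hf.norm_value_sub hx le_rfl (y := 0) (by simp)
  rwa [value_zero, hf.coeff_zero, sub_zero, sub_zero] at this

theorem IsIndifferentSeries.norm_iterate {f : L⟦X⟧} {a : ℝ} (hf : IsIndifferentSeries f a) {x : L}
    (hx : a * ‖x‖ < 1) (n : ℕ) : ‖(value f)^[n] x‖ = ‖x‖ := by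
  induction n with
  | zero => rfl
  | succ n ih => rw [Function.iterate_succ_apply', hf.norm_value (by rwa [ih]), ih]

theorem IsIndifferentSeries.norm_iterate_sub {f : L⟦X⟧} {a ρ : ℝ} (hf : IsIndifferentSeries f a)
    (haρ : a * ρ < 1) {x y : L} (hx : ‖x‖ ≤ ρ) (hy : ‖y‖ ≤ ρ) (n : ℕ) :
    ‖(value f)^[n] x - (value f)^[n] y‖ = ‖x - y‖ := by
  have hlt : ∀ z : L, ‖z‖ ≤ ρ → a * ‖z‖ < 1 := fun z hz =>
    (mul_le_mul_of_nonneg_left hz hf.nonneg).trans_lt haρ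
  induction n with
  | zero => rfl
  | succ n ih =>
    rw [Function.iterate_succ_apply', Function.iterate_succ_apply',
      hf.norm_value_sub haρ (by rwa [hf.norm_iterate (hlt x hx)])
        (by rwa [hf.norm_iterate (hlt y hy)]), ih]

/-- An iterate of an isometry has multiplier of absolute value one. -/
theorem IsIndifferentSeries.exists_hasDerivAt_iterate {f : L⟦X⟧} {a : ℝ}
    (hf : IsIndifferentSeries f a) {x : L} (hx : a * ‖x‖ < 1) (n : ℕ) :
    ∃ μ : L, HasDerivAt ((value f)^[n]) μ x ∧ ‖μ‖ = 1 := by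
  have hdiff : DifferentiableAt L ((value f)^[n]) x := by
    induction n with
    | zero => exact differentiableAt_id
    | succ n ih =>
      rw [Function.iterate_succ']
      exact (hf.differentiableAt (by rwa [hf.norm_iterate hx])).comp x ih
  obtain ⟨ρ, hxρ, haρ⟩ := exists_gt_mul_lt_one hx
  refine ⟨_, hdiff.hasDerivAt, ?_⟩
  have hball : ∀ᶠ y in 𝓝[≠] x, ‖y‖ < ρ :=
    nhdsWithin_le_nhds (continuous_norm.continuousAt.eventually (gt_mem_nhds hxρ))
  refine tendsto_nhds_unique hdiff.hasDerivAt.tendsto_slope.norm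
    (tendsto_const_nhds.congr' ?_)
  filter_upwards [hball, self_mem_nhdsWithin] with y hy hne
  have hne' : ‖y - x‖ ≠ 0 := norm_ne_zero_iff.mpr (sub_ne_zero.mpr hne)
  rw [slope_def_field, norm_div, hf.norm_iterate_sub haρ hy.le hxρ.le, div_self hne']

end Dynamics

/-! ### Conjugacy and its inverse -/

section Conjugacy

variable {L : Type*} [NontriviallyNormedField L]

/-- If the full conjugacy holds at some point of absolute value at least `τ`, then the series
inverse to `g` converges on the closed disc of radius `τ`. -/
theorem FullConjugacyOn.exists_inverse {f g : L⟦X⟧} {U : Set L} (hU : FullConjugacyOn f g U)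
    (hg0 : coeff 0 g = 0) (hg1 : coeff 1 g = 1) {τ : ℝ} (hτ : 0 ≤ τ) {y : L} (hy : y ∈ U)
    (hyτ : τ ≤ ‖y‖) : ∃ h : L⟦X⟧, subst g h = (X : L⟦X⟧) ∧
      Tendsto (fun k => ‖coeff k h‖ * τ ^ k) atTop (𝓝 0) := by
  obtain ⟨h, hh0, hgh, hconv⟩ := hU
  have hu : IsUnit (coeff 1 g) := hg1 ▸ isUnit_one
  have hgc : constantCoeff g = 0 := by simpa using hg0
  refine ⟨h, ?_, tendsto_mul_pow_of_le (fun _ => norm_nonneg _) hτ hyτ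
    (tendsto_norm_of_convergesAt (hconv y hy).1)⟩
  rw [eq_substInvOfIsUnit hgc hu (by simpa using hh0) hgh]
  exact subst_substInvOfIsUnit_left g hgc hu

variable [IsUltrametricDist L] [CompleteSpace L]

theorem value_conjugacy {f g : L⟦X⟧} {a : ℝ} (hf : IsIndifferentSeries f a)
    (hsch : subst f g = C (coeff 1 f) * g) {x : L} (hx : a * ‖x‖ < 1) (hgx : ConvergesAt g x) :
    value g (value f x) = coeff 1 f * value g x := by
  -- At `x = 0` there is no disc of positive radius to bound the terms of `f` on.
  rcases eq_or_ne x 0 with rfl | hx0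
  · have h0 := congrArg (coeff 0) hsch
    rw [coeff_C_mul] at h0
    rw [value_zero f, hf.coeff_zero, value_zero g]
    have hs : coeff 0 (subst f g) = coeff 0 g := by
      rw [coeff_subst_eq_tsum hf.coeff_zero, tsum_eq_single 0]
      · simp
      · intro k hk
        have hf0 : constantCoeff f = 0 := by simpa using hf.coeff_zero
        simp [hf0, hk]
    rw [← h0, hs]
  rw [← value_C_mul, ← hsch]
  exact (value_subst hf.coeff_zero (hf.convergesAt hx) (norm_nonneg x)
    ((hf.isSelfBounded (norm_nonneg x) hx.le).norm_le_norm (norm_pos_iff.mpr hx0) le_rfl)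
    (tendsto_norm_of_convergesAt hgx)).symm

theorem value_inverse_left {g h : L⟦X⟧} {τ : ℝ} (hτ : 0 < τ) (hg : IsSelfBounded g τ)
    (hhg : subst g h = (X : L⟦X⟧)) {x : L} (hx : ‖x‖ ≤ τ) (hgx : ConvergesAt g x)
    (hhx : ConvergesAt h x) : value h (value g x) = x := by
  rw [← value_subst hg.coeff_zero hgx (norm_nonneg x) (hg.norm_le_norm hτ hx)
    (tendsto_norm_of_convergesAt hhx), hhg, value_X]

theorem IsSelfBounded.convergesAt {p : L⟦X⟧} {τ : ℝ} (hτ : 0 < τ) (hp : IsSelfBounded p τ) {x : L}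
    (hx : ‖x‖ < τ) : ConvergesAt p x :=
  convergesAt_of_tendsto (hp.tendsto hτ (norm_nonneg x) hx)

/-- If `|b_k| τ ^ k ≤ τ` for all coefficients of the conjugacy, then the full conjugacy holds on the
open disc of radius `τ`: the inverse satisfies the same bounds, so all the series involved converge
on that disc and map it into itself. -/
theorem fullConjugacyOn_ball {f g : L⟦X⟧} {a τ : ℝ} (hτ : 0 < τ) (haτ : a * τ < 1)
    (hf : IsIndifferentSeries f a) (hg : IsSelfBounded g τ) (hg1 : coeff 1 g = 1)
    (hsch : subst f g = C (coeff 1 f) * g) : FullConjugacyOn f g (Metric.ball 0 τ) := by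
  have hu : IsUnit (coeff 1 g) := hg1 ▸ isUnit_one
  have hg0 : constantCoeff g = 0 := by simpa using hg.coeff_zero
  have hh0 : coeff 0 (g.substInvOfIsUnit hu) = 0 := by simp
  have hgh := subst_substInvOfIsUnit_right g hg0 hu
  have hh : IsSelfBounded (g.substInvOfIsUnit hu) τ :=
    ⟨hh0, norm_coeff_inverse_le hτ hg.coeff_zero hg1 hg.norm_le hh0 hgh⟩
  refine ⟨g.substInvOfIsUnit hu, hh0, hgh, fun x hx => ?_⟩
  rw [mem_ball_zero_iff] at hx
  set h := g.substInvOfIsUnit hu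
  have hhx := hh.convergesAt hτ hx
  have hnorm : ‖value h x‖ < τ := (hh.norm_value_le hτ hx.le).trans_lt hx
  have hax : a * ‖value h x‖ < 1 := (mul_le_mul_of_nonneg_left hnorm.le hf.nonneg).trans_lt haτ
  have hghx := hg.convergesAt hτ hnorm
  have hval : value g (value h x) = x := by
    rw [← value_subst hh0 hhx (norm_nonneg x) (hh.norm_le_norm hτ hx.le)
      (hg.tendsto hτ (norm_nonneg x) hx), hgh, value_X]
  refine ⟨hhx, hghx, hval, hf.convergesAt hax, hg.convergesAt hτ ?_, ?_⟩
  · rwa [hf.norm_value hax]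
  · rw [value_conjugacy hf hsch hax hghx, hval]

end Conjugacy

/-! ### The completed algebraic closure -/

section Khat

variable {K : Type*} [NontriviallyNormedField K] [IsUltrametricDist K] [CompleteSpace K]

instance isUltrametricDist_Khat : IsUltrametricDist (Khat K) :=
  IsUltrametricDist.of_normedAlgebra K

theorem norm_coeff_toKhat (p : K⟦X⟧) (k : ℕ) : ‖coeff k (toKhat K p)‖ = ‖coeff k p‖ := by
  rw [toKhat, coeff_map, norm_algebraMap_Khat]

theorem coeff_zero_toKhat {p : K⟦X⟧} (hp : coeff 0 p = 0) : coeff 0 (toKhat K p) = 0 := by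
  rw [toKhat, coeff_map, hp, map_zero]

theorem coeff_one_toKhat {p : K⟦X⟧} (hp : coeff 1 p = 1) : coeff 1 (toKhat K p) = 1 := by
  rw [toKhat, coeff_map, hp, map_one]

/-- Polynomials over `K` split over `Khat K`, already over the algebraic closure of `K`. -/
theorem splits_trunc_toKhat (p : K⟦X⟧) (N : ℕ) : (trunc N (toKhat K p)).Splits := by
  rw [toKhat, trunc_map, IsScalarTower.algebraMap_eq K (AlgebraicClosure K) (Khat K),
    ← Polynomial.map_map]
  exact (IsAlgClosed.splits _).map _

theorem subst_toKhat {p q : K⟦X⟧} (hq : coeff 0 q = 0) :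
    subst (toKhat K q) (toKhat K p) = toKhat K (subst q p) :=
  (map_subst (HasSubst.of_constantCoeff_zero' (by simpa using hq)) p).symm

theorem IsIndifferentSeries.toKhat {f : K⟦X⟧} {a : ℝ} (hf : IsIndifferentSeries f a) :
    IsIndifferentSeries (toKhat K f) a where
  coeff_zero := coeff_zero_toKhat hf.coeff_zero
  norm_coeff_one := by rw [norm_coeff_toKhat, hf.norm_coeff_one]
  nonneg := hf.nonneg
  norm_coeff_succ_le k := by
    rw [norm_coeff_toKhat]
    exact hf.norm_coeff_succ_le k

end Khat

/-! ### Zeros of the conjugacy and periodic points -/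

section Periodic

variable {L : Type*} [NontriviallyNormedField L]

/-- The power series `g / X`, for a power series `g` without constant term. -/
noncomputable def divX (g : L⟦X⟧) : L⟦X⟧ := PowerSeries.mk fun k => coeff (k + 1) g

theorem coeff_divX (g : L⟦X⟧) (k : ℕ) : coeff k (divX g) = coeff (k + 1) g := coeff_mk _ _

theorem isGreatest_dominantIndices_divX {g : L⟦X⟧} {r : ℝ} (hr : 0 < r) {d : ℕ}
    (hd : IsGreatest (dominantIndices g r) (d + 1)) :
    IsGreatest (dominantIndices (divX g) r) d := by
  have h : ∀ k, ‖coeff k (divX g)‖ * r ^ k * r = ‖coeff (k + 1) g‖ * r ^ (k + 1) := fun k => by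
    rw [coeff_divX]; ring
  refine isGreatest_dominantIndices_of_lt (fun j => ?_) fun j hj => ?_
  · exact le_of_mul_le_mul_right (by rw [h, h]; exact hd.1 _) hr
  · refine lt_of_mul_lt_mul_right ?_ hr.le
    rw [h, h]
    exact lt_of_isGreatest_dominantIndices hd (by lia)

theorem tendsto_divX {g : L⟦X⟧} {r : ℝ} (hr : 0 < r)
    (hg : Tendsto (fun k => ‖coeff k g‖ * r ^ k) atTop (𝓝 0)) :
    Tendsto (fun k => ‖coeff k (divX g)‖ * r ^ k) atTop (𝓝 0) := by
  have h := ((tendsto_add_atTop_iff_nat 1).mpr hg).mul_const r⁻¹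
  rw [zero_mul] at h
  refine h.congr fun k => ?_
  rw [coeff_divX, pow_succ]
  field_simp

theorem value_eq_mul_value_divX {g : L⟦X⟧} (hg0 : coeff 0 g = 0) {x : L} (hx : ConvergesAt g x) :
    value g x = x * value (divX g) x := by
  rw [value, Summable.tsum_eq_zero_add hx, hg0, zero_mul, zero_add, value, ← tsum_mul_left]
  refine tsum_congr fun k => ?_
  rw [coeff_divX]; ring

variable [IsUltrametricDist L] [CompleteSpace L]

/-- A zero of the conjugacy `g` on the sphere of radius `τ`: the series `g / X` has a zero on the
closed disc because its Weierstrass degree there is positive, and no zero on the open disc because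
`g` is injective there. -/
theorem exists_zero_on_sphere {g : L⟦X⟧} (hsplit : ∀ N, (trunc N (divX g)).Splits) {τ : ℝ}
    (hτ : 0 < τ) (hg : IsSelfBounded g τ) (hg1 : coeff 1 g = 1)
    (hlim : Tendsto (fun k => ‖coeff k g‖ * τ ^ k) atTop (𝓝 0)) {d : ℕ} (hd0 : d ≠ 0)
    (hd : IsGreatest (dominantIndices g τ) (d + 1)) :
    ∃ x : L, ‖x‖ = τ ∧ value g x = 0 := by
  obtain ⟨x, hx, hx0⟩ := exists_value_eq_zero hsplit hτ (isGreatest_dominantIndices_divX hτ hd) hd0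
    (tendsto_divX hτ hlim)
  have hgx : ConvergesAt g x := convergesAt_of_tendsto
    (tendsto_mul_pow_of_le (fun _ => norm_nonneg _) (norm_nonneg _) hx hlim)
  have hval : value g x = 0 := by rw [value_eq_mul_value_divX hg.coeff_zero hgx, hx0, mul_zero]
  refine ⟨x, hx.eq_of_not_lt fun hlt => ?_, hval⟩
  have hu : IsUnit (coeff 1 g) := hg1 ▸ isUnit_one
  have hg0 : constantCoeff g = 0 := by simpa using hg.coeff_zero
  have hh0 : coeff 0 (g.substInvOfIsUnit hu) = 0 := by simp
  have hh : IsSelfBounded (g.substInvOfIsUnit hu) τ := ⟨hh0, norm_coeff_inverse_le hτ hg.coeff_zero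
    hg1 hg.norm_le hh0 (subst_substInvOfIsUnit_right g hg0 hu)⟩
  have h0 := value_inverse_left hτ hg (subst_substInvOfIsUnit_left g hg0 hu) hx hgx
    (hh.convergesAt hτ hlt)
  rw [hval, value_zero, hh0] at h0
  rw [← h0, value_zero, coeff_divX, hg1] at hx0
  exact one_ne_zero hx0

/-- A nonzero zero `x` of the conjugacy is a periodic point of `f`: its orbit stays among the zeros
of `g / X`, of which there are at most `d`, and `f` is injective. -/
theorem isIndifferentPeriodicPt_of_value_eq_zero {f g : L⟦X⟧} {a τ : ℝ}
    (hf : IsIndifferentSeries f a) (haτ : a * τ < 1) (hsch : subst f g = C (coeff 1 f) * g)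
    (hsplit : ∀ N, (trunc N (divX g)).Splits) (hτ : 0 < τ) (hg0 : coeff 0 g = 0)
    (hlim : Tendsto (fun k => ‖coeff k g‖ * τ ^ k) atTop (𝓝 0)) {d : ℕ}
    (hd : IsGreatest (dominantIndices g τ) (d + 1)) {x : L} (hx : ‖x‖ = τ)
    (hgx : value g x = 0) : ∃ κ ≤ d, IsIndifferentPeriodicPt f x κ := by
  classical
  have hax : a * ‖x‖ < 1 := by rwa [hx]
  have hnorm : ∀ n, ‖(value f)^[n] x‖ = τ := fun n => by rw [hf.norm_iterate hax, hx]
  have hconv : ∀ n, ConvergesAt g ((value f)^[n] x) := fun n =>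
    convergesAt_of_tendsto (by rwa [hnorm])
  have hzero : ∀ n, value g ((value f)^[n] x) = 0 := by
    intro n
    induction n with
    | zero => exact hgx
    | succ n ih =>
      rw [Function.iterate_succ_apply', value_conjugacy hf hsch (by rwa [hnorm]) (hconv n), ih,
        mul_zero]
  have hzero' : ∀ n, value (divX g) ((value f)^[n] x) = 0 := fun n => by
    have h := hzero n
    rw [value_eq_mul_value_divX hg0 (hconv n)] at h
    exact (mul_eq_zero.mp h).resolve_left (norm_pos_iff.mp (by rwa [hnorm]))
  have hcard : ((Finset.range (d + 1)).image fun n => (value f)^[n] x).card ≤ d := by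
    refine card_le_of_value_eq_zero hsplit hτ (isGreatest_dominantIndices_divX hτ hd)
      (tendsto_divX hτ hlim) _ fun z hz => ?_
    obtain ⟨n, -, rfl⟩ := Finset.mem_image.mp hz
    exact ⟨(hnorm n).le, hzero' n⟩
  obtain ⟨i, hi, j, hj, hij, heq⟩ := Finset.exists_ne_map_eq_of_card_lt_of_maps_to
    (s := Finset.range (d + 1)) (f := fun n => (value f)^[n] x)
    (by rw [Finset.card_range]; lia) fun n hn => Finset.mem_image_of_mem _ hn
  obtain ⟨n, hn0, hnd, hper⟩ : ∃ n, 0 < n ∧ n ≤ d ∧ Function.IsPeriodicPt (value f) n x := by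
    wlog hlt : i < j generalizing i j
    · exact this j hj i hi hij.symm heq.symm (by lia)
    have hjd := Finset.mem_range.mp hj
    refine ⟨j - i, by lia, by lia, ?_⟩
    have hadd : (value f)^[j] x = (value f)^[i] ((value f)^[j - i] x) := by
      rw [← Function.iterate_add_apply, Nat.add_sub_cancel' hlt.le]
    have h := hf.norm_iterate_sub haτ (hnorm (j - i)).le hx.le i
    rw [← hadd, ← heq, sub_self, norm_zero, eq_comm, norm_eq_zero, sub_eq_zero] at h
    exact h
  refine ⟨Function.minimalPeriod (value f) x, (hper.minimalPeriod_le hn0).trans hnd,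
    fun n => hf.convergesAt (by rwa [hnorm]), hper.minimalPeriod_pos hn0, rfl,
    hf.exists_hasDerivAt_iterate hax _⟩

end Periodic

/-! ### The linearization disc -/

section LinearizationDisc

variable {L : Type*} [NontriviallyNormedField L]

/-- The open disc of radius `τ` is the linearization disc if the full conjugacy holds there and on no
set with a point outside. -/
theorem isLinearizationDisc_ball {f g : L⟦X⟧} {τ : ℝ}
    (hτ : 0 < τ) (hball : FullConjugacyOn f g (Metric.ball 0 τ))
    (hmax : ∀ U, FullConjugacyOn f g U → ∀ y ∈ U, ‖y‖ < τ) :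
    IsLinearizationDisc f g (Metric.ball 0 τ) :=
  ⟨⟨⟨τ, hτ, Or.inl rfl⟩, hball⟩, fun U hU y hy => mem_ball_zero_iff.mpr (hmax U hU.2 y hy)⟩

/-- The inverse of `g` does not converge on the closed disc of radius `‖x‖` if `x` is a nonzero
zero of `g`: there `g` would be injective. -/
theorem not_tendsto_inverse [IsUltrametricDist L] [CompleteSpace L] {g h : L⟦X⟧} {x : L}
    (hx0 : x ≠ 0) (hg : IsSelfBounded g ‖x‖)
    (hgc : ConvergesAt g x) (hgx : value g x = 0) (hhg : subst g h = (X : L⟦X⟧))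
    (hh : Tendsto (fun k => ‖coeff k h‖ * ‖x‖ ^ k) atTop (𝓝 0)) : False := by
  have h1 := value_inverse_left (norm_pos_iff.mpr hx0) hg hhg le_rfl hgc
    (convergesAt_of_tendsto hh)
  have h2 := congrArg (coeff 0) hhg
  rw [coeff_subst_eq_tsum hg.coeff_zero, tsum_eq_single 0, pow_zero, coeff_zero_one, mul_one,
    coeff_zero_X] at h2
  · rw [hgx, value_zero, h2] at h1
    exact hx0 h1.symm
  · intro k hk
    have hg0 : constantCoeff g = 0 := by simpa using hg.coeff_zero
    simp [hg0, hk]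

end LinearizationDisc

end NonArch

end

theorem mainTheorem4 {K : Type*} [NontriviallyNormedField K] [IsUltrametricDist K]
    [CompleteSpace K] (f g : PowerSeries K) (lam : K) (a τ : ℝ) (d : ℕ)
    (hf0 : PowerSeries.coeff 0 f = 0) (hf1 : PowerSeries.coeff 1 f = lam) (hlam : ‖lam‖ = 1)
    (ha : IsLUB {s : ℝ | ∃ i : ℕ, 2 ≤ i ∧ s = ‖PowerSeries.coeff i f‖ ^ (1 / ((i : ℝ) - 1))} a)
    (hg : NonArch.IsConjugacy f g)
    -- `τ < 1 / a`, where `1 / a = ∞` if `a = 0`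
    (hτ : a * τ < 1)
    (hopen : NonArch.HasDegreeOnOpenDisc (NonArch.toKhat K g) τ 1)
    (hclosed : NonArch.HasDegreeOnClosedDisc (NonArch.toKhat K g) τ d)
    (hd : 1 < d) :
    (∃ x : NonArch.Khat K, x ∈ Metric.sphere (0 : NonArch.Khat K) τ ∧
      ∃ κ : ℕ, κ ≤ d ∧ NonArch.IsIndifferentPeriodicPt (NonArch.toKhat K f) x κ) ∧
    NonArch.IsLinearizationDisc (NonArch.toKhat K f) (NonArch.toKhat K g)
      (Metric.ball (0 : NonArch.Khat K) τ) ∧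
    NonArch.IsLinearizationDisc f g (Metric.ball (0 : K) τ) := by
  open NonArch in
  obtain ⟨⟨-, hτ0, c, -, hτc, hconv⟩, hleast⟩ := hopen
  obtain ⟨e, rfl⟩ : ∃ e, d = e + 1 := ⟨d - 1, by lia⟩
  have hf : IsIndifferentSeries f a := isIndifferentSeries_of_isLUB hf0 (hf1 ▸ hlam) ha
  have hfK := hf.toKhat
  have hg0K := coeff_zero_toKhat hg.coeff_zero
  have hg1K := coeff_one_toKhat hg.coeff_one
  have hgK : IsSelfBounded (toKhat K g) τ :=
    ⟨hg0K, fun k => by simpa only [hg1K, norm_one, one_mul, pow_one] using hleast.1 k⟩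
  have hgb : IsSelfBounded g τ := ⟨hg.coeff_zero, fun k => by
    simpa only [norm_coeff_toKhat] using hgK.norm_le k⟩
  have hlim : Filter.Tendsto (fun k => ‖PowerSeries.coeff k (toKhat K g)‖ * τ ^ k) Filter.atTop
      (nhds 0) :=
    tendsto_mul_pow_of_le (fun _ => norm_nonneg _) hτ0.le hτc
      (tendsto_norm_of_convergesAt (hconv c le_rfl))
  have hschK : PowerSeries.subst (toKhat K f) (toKhat K g) =
      PowerSeries.C (PowerSeries.coeff 1 (toKhat K f)) * toKhat K g := by
    rw [subst_toKhat hf0, hg.schroeder]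
    simp [toKhat]
  have hsplit : ∀ N, (PowerSeries.trunc N (divX (toKhat K g))).Splits := fun N => by
    have h : divX (toKhat K g) = toKhat K (divX g) := by
      ext k
      simp [toKhat, coeff_divX]
    rw [h]
    exact splits_trunc_toKhat _ N
  obtain ⟨x, hx, hgx⟩ := exists_zero_on_sphere hsplit hτ0 hgK hg1K hlim (by lia) hclosed.2
  have hx0 : x ≠ 0 := norm_pos_iff.mp (by rwa [hx])
  obtain ⟨κ, hκ, hper⟩ := isIndifferentPeriodicPt_of_value_eq_zero hfK hτ hschK hsplit hτ0 hg0K hlim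
    hclosed.2 hx hgx
  have hnot : ∀ h : PowerSeries (Khat K),
      PowerSeries.subst (toKhat K g) h = (PowerSeries.X : PowerSeries (Khat K)) →
      Filter.Tendsto (fun k => ‖PowerSeries.coeff k h‖ * τ ^ k) Filter.atTop (nhds 0) → False := by
    intro h hhg hh
    rw [← hx] at hgK hh hlim
    exact not_tendsto_inverse hx0 hgK (convergesAt_of_tendsto hlim) hgx hhg hh
  refine ⟨⟨x, mem_sphere_zero_iff_norm.mpr hx, κ, by lia, hper⟩,
    isLinearizationDisc_ball hτ0 (fullConjugacyOn_ball hτ0 hτ hfK hgK hg1K hschK)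
      fun U hU y hy => ?_,
    isLinearizationDisc_ball hτ0 (fullConjugacyOn_ball hτ0 hτ hf hgb hg.coeff_one hg.schroeder)
      fun U hU y hy => ?_⟩
  · by_contra hlt
    obtain ⟨h, hhg, hh⟩ := hU.exists_inverse hg0K hg1K hτ0.le hy (not_lt.mp hlt)
    exact hnot h hhg hh
  -- The sphere of radius `τ` may have no points in `K`: the inverse is moved to `Khat K`.
  · by_contra hlt
    obtain ⟨h, hhg, hh⟩ := hU.exists_inverse hg.coeff_zero hg.coeff_one hτ0.le hy (not_lt.mp hlt)
    refine hnot (toKhat K h) ?_ (by simpa only [norm_coeff_toKhat] using hh)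
    rw [subst_toKhat hg.coeff_zero, hhg]
    exact PowerSeries.map_X _
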